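/- Let $K$ be an algebraically closed field that is complete with respect to a nontrivial nonarchimedean absolute value $|\cdot|$, and let $\|x\|=\max_i|x_i|$ on $K^{N+1}$. Equip $\mathbb{P}^N(K)$ with the chordal metric $$\Delta(P,Q)=\frac{\max_{i,j}|x_iy_j-x_jy_i|}{\|x\|\,\|y\|}\qquad\text{for } P=(x_0:\cdots:x_N),\ Q=(y_0:\cdots:y_N),$$ and put $D_r(P)=\{Q:\Delta(P,Q)<r\}$. Let $\varphi:\mathbb{P}^N\to\mathbb{P}^N$ be a morphism over $K$ of degree $d\ge 2$. A lift of $\varphi$ is a tuple $\Phi=(\Phi_0,\dots,\Phi_N)$ of homogeneous polynomials of degree $d$ over $K$, without common zero in $K^{N+1}\setminus\{0\}$, that induces $\varphi$. Write $\|\Phi\|$ for the maximum of the absolute values of the coefficients of $\Phi$; the lift is minimal if $\|\Phi\|=1$. Let $\Phi$ be a minimal lift of $\varphi$, and let $|\operatorname{Res}(\varphi)|=|\operatorname{Res}(\Phi)|$ be the absolute value of its Macaulay resultant. Define $$\hat g_\Phi(P)=\lim_{n\to\infty}\frac1{d^n}\log\|\Phi^n(x)\|-\log\|x\|,$$ where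 $x$ is any lift of $P$; the limit exists, and the value does not depend on $x$. The morphism $\varphi$ has good reduction at $P$ if there are a lift $\Psi$ of $\varphi$ and a lift $x$ of $P$ with $\|x\|=\|\Psi\|=\|\Psi(x)\|=1$, and bad reduction at $P$ otherwise. It has orbital good reduction at $P$ if it has good reduction at $\varphi^n(P)$ for all $n\ge 0$. Let $U^{\mathrm{orb}}(\varphi)$ be the set of points of orbital good reduction. The Fatou set $\mathcal F(\varphi)$ is the union of all open subsets of $\mathbb{P}^N(K)$ at every point of which the family $\{\varphi^n\}_{n\ge1}$ is equicontinuous for $\Delta$. Then: (a) If $P\in U^{\mathrm{orb}}(\varphi)$ and $Q,R\in D_{|\operatorname{Res}(\varphi)|}(P)$, then $\Delta(\varphi^n(Q),\varphi^n(R))\le\Delta(Q,R)$ for all $n\ge1$. (b) If $P\in U^{\mathrm{orb}}(\varphi)$, then $D_{|\operatorname{Res}(\varphi)|}(P)\subseteq U^{\mathrm{orb}}(\varphi)$. Moreover, $U^{\mathrm{orb}}(\varphi)$ is open. (c) $U^{\mathrm{orb}}(\varphi)=\{P\in\mathbb{P}^N(K):\hat g_\Phi(P)=0\}\subseteq\mathcal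 F(\varphi)$. (d) $\hat g_\Phi(P)<0$ at every point $P$ of bad reduction. (e) The set $\{P\in\mathbb{P}^N(K):\hat g_\Phi(P)=0\}$ is open. -/

import Mathlib

open Filter Topology LinearAlgebra.Projectivization

noncomputable section

namespace ProjDyn

/-! ### The chordal metric on projective space -/

/-- The set `ℙ^N(K)`. -/
abbrev PSpace (K : Type*) [Field K] (N : ℕ) : Type _ := ℙ K (Fin (N + 1) → K)

/-- `max_{i,j} |x_i y_j - x_j y_i| / (‖x‖ ‖y‖)`; all norms are sup norms. -/
def chordalVec {K : Type*} [NormedField K] {N : ℕ} (x y : Fin (N + 1) → K) : ℝ :=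
  ‖(fun p : Fin (N + 1) × Fin (N + 1) => x p.1 * y p.2 - x p.2 * y p.1)‖ / (‖x‖ * ‖y‖)

lemma chordalVec_smul_smul {K : Type*} [NormedField K] {N : ℕ} (x y : Fin (N + 1) → K)
    {a b : K} (ha : a ≠ 0) (hb : b ≠ 0) :
    chordalVec (a • x) (b • y) = chordalVec x y := by
  have h : (fun p : Fin (N + 1) × Fin (N + 1) =>
      (a • x) p.1 * (b • y) p.2 - (a • x) p.2 * (b • y) p.1)
      = (a * b) • (fun p : Fin (N + 1) × Fin (N + 1) => x p.1 * y p.2 - x p.2 * y p.1) := by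
    funext p
    simp only [Pi.smul_apply, smul_eq_mul]
    ring
  have ha' : ‖a‖ ≠ 0 := norm_ne_zero_iff.mpr ha
  have hb' : ‖b‖ ≠ 0 := norm_ne_zero_iff.mpr hb
  unfold chordalVec
  rw [h, norm_smul, norm_smul, norm_smul, norm_mul,
    show ‖a‖ * ‖x‖ * (‖b‖ * ‖y‖) = (‖a‖ * ‖b‖) * (‖x‖ * ‖y‖) by ring,
    mul_div_mul_left _ _ (mul_ne_zero ha' hb')]

/-- The chordal distance on `ℙ^N(K)`, computed on lifts of the two points. -/
def chordalDist {K : Type*} [NormedField K] {N : ℕ} (P Q : PSpace K N) : ℝ :=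
  chordalVec P.rep Q.rep

lemma chordalDist_mk {K : Type*} [NormedField K] {N : ℕ} (x y : Fin (N + 1) → K)
    (hx : x ≠ 0) (hy : y ≠ 0) :
    chordalDist (Projectivization.mk K x hx) (Projectivization.mk K y hy) = chordalVec x y := by
  obtain ⟨a, ha⟩ := Projectivization.exists_smul_eq_mk_rep K x hx
  obtain ⟨b, hb⟩ := Projectivization.exists_smul_eq_mk_rep K y hy
  unfold chordalDist
  rw [← ha, ← hb]
  exact chordalVec_smul_smul x y a.ne_zero b.ne_zero

lemma chordalVec_triangle {K : Type*} [NormedField K] [IsUltrametricDist K] {N : ℕ}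
    (x y z : Fin (N + 1) → K) (hx : x ≠ 0) (hy : y ≠ 0) (hz : z ≠ 0) :
    chordalVec x z ≤ max (chordalVec x y) (chordalVec y z) := by
  have hx' : 0 < ‖x‖ := norm_pos_iff.mpr hx
  have hy' : 0 < ‖y‖ := norm_pos_iff.mpr hy
  have hz' : 0 < ‖z‖ := norm_pos_iff.mpr hz
  set M := max (chordalVec x y) (chordalVec y z) with hM
  have key : ∀ (u v : Fin (N + 1) → K), 0 < ‖u‖ → 0 < ‖v‖ → chordalVec u v ≤ M →
      ∀ i j, ‖u i * v j - u j * v i‖ ≤ M * (‖u‖ * ‖v‖) := by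
    intro u v hu hv h i j
    refine le_trans (norm_le_pi_norm
      (fun p : Fin (N + 1) × Fin (N + 1) => u p.1 * v p.2 - u p.2 * v p.1) (i, j)) ?_
    exact (div_le_iff₀ (mul_pos hu hv)).mp h
  have hxy := key x y hx' hy' (le_max_left _ _)
  have hyz := key y z hy' hz' (le_max_right _ _)
  have hM0 : 0 ≤ M := le_trans (by unfold chordalVec; positivity) (le_max_left _ _)
  obtain ⟨j, hj⟩ : ∃ j, ‖y j‖ = ‖y‖ := by
    obtain ⟨j, -, hj⟩ := Finset.exists_mem_eq_sup' (Finset.univ_nonempty (α := Fin (N + 1)))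
      (fun i => ‖y i‖₊)
    refine ⟨j, ?_⟩
    rw [Pi.norm_def, ← Finset.sup'_eq_sup Finset.univ_nonempty, hj]
    rfl
  unfold chordalVec
  rw [div_le_iff₀ (mul_pos hx' hz')]
  refine (pi_norm_le_iff_of_nonneg (by positivity)).mpr ?_
  rintro ⟨i, k⟩
  have e : (x i * z k - x k * z i) * y j
      = (x i * y j - x j * y i) * z k + (y i * z k - y k * z i) * x j
        + (x j * y k - x k * y j) * z i := by ring
  have b : ∀ (s : K) (c : Fin (N + 1) → K) (l : Fin (N + 1)) (C : ℝ), 0 ≤ C →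
      ‖s‖ ≤ C → ‖s * c l‖ ≤ C * ‖c‖ := by
    intro s c l C hC hs
    rw [norm_mul]
    exact mul_le_mul hs (norm_le_pi_norm c l) (norm_nonneg _) hC
  have h1 := b _ z k _ (by positivity) (hxy i j)
  have h2 := b _ x j _ (by positivity) (hyz i k)
  have h3 := b _ z i _ (by positivity) (hxy j k)
  have h4 : ‖(x i * z k - x k * z i) * y j‖ ≤ M * (‖x‖ * ‖z‖) * ‖y‖ := by
    rw [e]
    refine le_trans (IsUltrametricDist.norm_add_le_max _ _)
      (max_le (le_trans (IsUltrametricDist.norm_add_le_max _ _) (max_le ?_ ?_)) ?_)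
    · linarith
    · linarith
    · linarith
  rw [norm_mul, hj] at h4
  exact le_of_mul_le_mul_right h4 hy'

/-- `ℙ^N(K)` carries the metric given by the chordal distance. -/
instance instMetricSpacePSpace {K : Type*} [NormedField K] [IsUltrametricDist K] {N : ℕ} :
    MetricSpace (PSpace K N) where
  dist := chordalDist
  dist_self P := by
    simp [chordalDist, chordalVec, mul_comm, Pi.norm_def]
  dist_comm P Q := by
    unfold chordalDist chordalVec
    rw [mul_comm ‖P.rep‖, ← norm_neg]
    congr 2
    funext p
    simp only [Pi.neg_apply]
    ring
  dist_triangle P Q R := by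
    refine le_trans (chordalVec_triangle P.rep Q.rep R.rep P.rep_nonzero Q.rep_nonzero
      R.rep_nonzero) (max_le_add_of_nonneg ?_ ?_)
    · unfold chordalVec; positivity
    · unfold chordalVec; positivity
  eq_of_dist_eq_zero := by
    intro P Q h
    have hP : ‖P.rep‖ ≠ 0 := norm_ne_zero_iff.mpr P.rep_nonzero
    have hQ : ‖Q.rep‖ ≠ 0 := norm_ne_zero_iff.mpr Q.rep_nonzero
    have h' : chordalVec P.rep Q.rep = 0 := h
    unfold chordalVec at h'
    rw [div_eq_zero_iff, or_iff_left (mul_ne_zero hP hQ), norm_eq_zero] at h'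
    obtain ⟨j, hj⟩ := Function.ne_iff.mp Q.rep_nonzero
    rw [← P.mk_rep, ← Q.mk_rep, Projectivization.mk_eq_mk_iff']
    refine ⟨P.rep j / Q.rep j, ?_⟩
    funext i
    have hij := congrFun h' (i, j)
    simp only [Pi.zero_apply] at hij hj
    simp only [Pi.smul_apply, smul_eq_mul]
    field_simp
    linear_combination -hij

/-! ### Morphisms of projective space and their lifts -/

/-- An `(N+1)`-tuple of polynomials in the variables `X_0, …, X_N`. -/
abbrev PolyMap (K : Type*) [Field K] (N : ℕ) : Type _ :=
  Fin (N + 1) → MvPolynomial (Fin (N + 1)) K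

/-- The induced map `K^{N+1} → K^{N+1}`. -/
def PolyMap.app {K : Type*} [Field K] {N : ℕ} (Φ : PolyMap K N) (x : Fin (N + 1) → K) :
    Fin (N + 1) → K :=
  fun i => MvPolynomial.eval x (Φ i)

/-- `Φ` is a degree `d` lift of the self-map `f` of `ℙ^N(K)`: its components are homogeneous of
degree `d` without a nontrivial common zero, and `f(π(x)) = π(Φ(x))`. -/
structure IsLift {K : Type*} [Field K] {N : ℕ} (d : ℕ) (Φ : PolyMap K N)
    (f : PSpace K N → PSpace K N) : Prop where
  homogeneous : ∀ i, (Φ i).IsHomogeneous d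
  app_ne_zero : ∀ x, x ≠ 0 → Φ.app x ≠ 0
  map_mk : ∀ (x : Fin (N + 1) → K) (hx : x ≠ 0),
    f (Projectivization.mk K x hx) = Projectivization.mk K (Φ.app x) (app_ne_zero x hx)

/-- Morphisms `ℙ^N → ℙ^N` of degree `d` over the algebraically closed field `K`, as maps on
`K`-points. -/
structure ProjMorphism (K : Type*) [Field K] (N d : ℕ) where
  toFun : PSpace K N → PSpace K N
  exists_lift : ∃ Φ : PolyMap K N, IsLift d Φ toFun

instance instCoeFunProjMorphism {K : Type*} [Field K] {N d : ℕ} :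
    CoeFun (ProjMorphism K N d) (fun _ => PSpace K N → PSpace K N) :=
  ⟨ProjMorphism.toFun⟩

/-- A minimal lift: all coefficients have absolute value at most `1`, and one of them is a unit. -/
structure IsMinimalLift {K : Type*} [NormedField K] {N d : ℕ} (φ : ProjMorphism K N d)
    (Φ : PolyMap K N) : Prop where
  isLift : IsLift d Φ φ
  integral : ∀ i m, ‖(Φ i).coeff m‖ ≤ 1
  exists_unit : ∃ i m, ‖(Φ i).coeff m‖ = 1

/-- `‖Φ‖`, the maximum of the absolute values of all coefficients of `Φ`. -/
def PolyMap.coeffNorm {K : Type*} [NormedField K] {N : ℕ} (Φ : PolyMap K N) : ℝ :=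
  ((Finset.univ.sup fun i => (Φ i).support.sup fun m => ‖(Φ i).coeff m‖₊ : NNReal) : ℝ)

/-! ### The Macaulay resultant

Let `F_0, …, F_N` be the generic forms of degree `d` in `X_0, …, X_N`, with coefficients in the
ring `ℤ[u]` of the universal coefficients `u_{i,α}`. For `t = (N+1)(d-1)+1`, the resultant is the
greatest common divisor in `ℤ[u]` of the maximal minors of the matrix of
`(G_0, …, G_N) ↦ ∑ G_i F_i`, from `(N+1)`-tuples of forms of degree `t - d = N(d-1)` to forms of
degree `t`, with the sign chosen so that `X_0^d, …, X_N^d` has resultant `1`. -/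

/-- Exponent vectors of the monomials of degree `t` in `X_0, …, X_N`. -/
abbrev Mon (N t : ℕ) : Type :=
  {m : Fin (N + 1) →₀ ℕ // m ∈ (Finset.univ : Finset (Fin (N + 1))).finsuppAntidiag t}

/-- The ring `ℤ[u_{i,α}]` of universal coefficients. -/
abbrev UnivCoeff (N d : ℕ) : Type := MvPolynomial (Fin (N + 1) × Mon N d) ℤ

/-- The generic form `F_i = ∑_α u_{i,α} X^α` of degree `d`. -/
def genericForm (N d : ℕ) (i : Fin (N + 1)) : MvPolynomial (Fin (N + 1)) (UnivCoeff N d) :=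
  ∑ α : Mon N d, MvPolynomial.monomial α.1 (MvPolynomial.X (i, α))

/-- The column `(i, β)` holds the coefficients of `X^β F_i`. -/
def macaulayMatrix (N d : ℕ) :
    Matrix (Mon N ((N + 1) * (d - 1) + 1)) (Fin (N + 1) × Mon N (N * (d - 1))) (UnivCoeff N d) :=
  fun m c => (MvPolynomial.monomial c.2.1 1 * genericForm N d c.1).coeff m.1

/-- The greatest common divisor of the maximal minors (defined up to sign). -/
def macaulayGcd (N d : ℕ) : UnivCoeff N d :=
  letI : StrongNormalizationMonoid (UnivCoeff N d) :=
    UniqueFactorizationMonoid.strongNormalizationMonoid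
  letI : NormalizedGCDMonoid (UnivCoeff N d) :=
    UniqueFactorizationMonoid.toNormalizedGCDMonoid (UnivCoeff N d)
  (Finset.univ : Finset
      (Mon N ((N + 1) * (d - 1) + 1) → Fin (N + 1) × Mon N (N * (d - 1)))).gcd
    fun s => ((macaulayMatrix N d).submatrix id s).det

/-- The value (`1` or `-1`) of `macaulayGcd` at the system `X_0^d, …, X_N^d`. -/
def macaulaySign (N d : ℕ) : ℤ :=
  MvPolynomial.eval
    (fun c : Fin (N + 1) × Mon N d => if c.2.1 = Finsupp.single c.1 d then 1 else 0)
    (macaulayGcd N d)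

/-- The Macaulay resultant of `N+1` forms of degree `d`, as a polynomial in their coefficients. -/
def macaulayResultant (N d : ℕ) : UnivCoeff N d :=
  MvPolynomial.C (macaulaySign N d) * macaulayGcd N d

/-- The resultant `Res(Φ)` of `N+1` forms of degree `d` over `K`. -/
def PolyMap.res {K : Type*} [Field K] {N : ℕ} (d : ℕ) (Φ : PolyMap K N) : K :=
  MvPolynomial.eval₂ (Int.castRingHom K)
    (fun c : Fin (N + 1) × Mon N d => (Φ c.1).coeff c.2.1) (macaulayResultant N d)

/-! ### Green functions, good reduction, and the Fatou set -/

/-- The Green function `G_Φ(x) = lim_n d^{-n} log ‖Φ^n(x)‖`. -/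
def greenFunction {K : Type*} [NormedField K] {N : ℕ} (d : ℕ) (Φ : PolyMap K N)
    (x : Fin (N + 1) → K) : ℝ :=
  limUnder atTop fun n : ℕ => Real.log ‖Φ.app^[n] x‖ / (d : ℝ) ^ n

/-- The modified Green function `ĝ_Φ(P) = G_Φ(x) - log ‖x‖`, for a lift `x` of `P`. -/
def modifiedGreen {K : Type*} [NormedField K] {N : ℕ} (d : ℕ) (Φ : PolyMap K N)
    (P : PSpace K N) : ℝ :=
  greenFunction d Φ P.rep - Real.log ‖P.rep‖

/-- Good reduction at `P`: some lift `Φ` of `φ` and some lift `x` of `P` satisfy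
`‖x‖ = ‖Φ‖ = ‖Φ(x)‖ = 1`. -/
def HasGoodReductionAt {K : Type*} [NormedField K] {N d : ℕ} (φ : ProjMorphism K N d)
    (P : PSpace K N) : Prop :=
  ∃ (Φ : PolyMap K N) (x : Fin (N + 1) → K) (hx : x ≠ 0), IsLift d Φ φ ∧
    Projectivization.mk K x hx = P ∧ ‖x‖ = 1 ∧ Φ.coeffNorm = 1 ∧ ‖Φ.app x‖ = 1

def goodSet {K : Type*} [NormedField K] {N d : ℕ} (φ : ProjMorphism K N d) : Set (PSpace K N) :=
  {P | HasGoodReductionAt φ P}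

def badSet {K : Type*} [NormedField K] {N d : ℕ} (φ : ProjMorphism K N d) : Set (PSpace K N) :=
  (goodSet φ)ᶜ

/-- The points all of whose forward iterates (including the point itself) are points of good
reduction. -/
def orbitalGoodSet {K : Type*} [NormedField K] {N d : ℕ} (φ : ProjMorphism K N d) :
    Set (PSpace K N) :=
  {P | ∀ n : ℕ, φ^[n] P ∈ goodSet φ}

/-- The union of all open sets on which `φ, φ^2, φ^3, …` is equicontinuous for the chordal
metric. -/
def fatouSet {K : Type*} [NormedField K] [IsUltrametricDist K] {N d : ℕ}
    (φ : ProjMorphism K N d) : Set (PSpace K N) :=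
  ⋃₀ {U | IsOpen U ∧ ∀ P ∈ U, EquicontinuousAt (fun n : ℕ+ => φ^[(n : ℕ)]) P}

end ProjDyn

end

/-!
For a lift `Φ`, the number `λ(P) = d log ‖x‖ - log ‖Φ(x)‖` depends only on the point `P = [x]`, and
telescoping gives `-ĝ_Φ(P) = ∑ₙ λ(φⁿ(P)) / d ^ (n + 1)`; the series converges because the
Nullstellensatz bounds `λ`. If `Φ` is minimal then `λ ≥ 0`. Lifts of `φ` being unique up to scalars,
`λ(P) = 0` exactly when `φ` has good reduction at `P`, so `ĝ_Φ ≤ 0` vanishes exactly at the points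
of orbital good reduction. Two points at chordal distance `< 1` have lifts of norm `1` at that same
distance, and a polynomial map with integral coefficients does not expand the unit polydisc. So on
the open disc of radius `1` around a point of good reduction, all points have good reduction and
distances to the centre do not increase under `φ`. This disc contains the one of radius `|Res(Φ)|`,
as the resultant is an integer polynomial in the coefficients.
-/

namespace ProjDyn

open MvPolynomial

section CommonZeros

lemma isRelPrime_X_pow_X_pow {R σ : Type*} [CommRing R] [IsDomain R]
    [UniqueFactorizationMonoid R] {i j : σ} (hij : i ≠ j) (k l : ℕ) :
    IsRelPrime (X i ^ k : MvPolynomial σ R) (X j ^ l) := by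
  have hX : IsRelPrime (X i : MvPolynomial σ R) (X j) :=
    (X_prime (i := i)).irreducible.isRelPrime_iff_not_dvd.mpr fun h ↦ hij (X_dvd_X.mp h)
  exact hX.pow

variable {K σ ι : Type*} [Field K] [IsAlgClosed K] [Finite σ]

lemma exists_sum_mul_eq_X_pow [Fintype ι] {F : ι → MvPolynomial σ K}
    (hF : ∀ x : σ → K, x ≠ 0 → (fun i ↦ eval x (F i)) ≠ 0) (j : σ) :
    ∃ (k : ℕ) (G : ι → MvPolynomial σ K), ∑ i, G i * F i = X j ^ k := by
  have X_mem_radical : X j ∈ (Ideal.span (Set.range F)).radical := by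
    rw [← vanishingIdeal_zeroLocus_eq_radical (K := K), mem_vanishingIdeal_iff]
    intro x hx
    have x_eq_zero : x = 0 := by
      by_contra hx0
      refine hF x hx0 (funext fun i ↦ ?_)
      simpa using mem_zeroLocus_iff.mp hx _ (Ideal.subset_span ⟨i, rfl⟩)
    simp [x_eq_zero]
  obtain ⟨k, hk⟩ := X_mem_radical
  exact ⟨k, Ideal.mem_span_range_iff_exists_fun.mp hk⟩

lemma exists_X_pow_mul_eq_mul [Finite ι] {F G : ι → MvPolynomial σ K}
    (hF : ∀ x : σ → K, x ≠ 0 → (fun i ↦ eval x (F i)) ≠ 0)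
    (hFG : ∀ i j, G i * F j = G j * F i) (j : σ) :
    ∃ (k : ℕ) (H : MvPolynomial σ K), ∀ i, X j ^ k * G i = H * F i := by
  cases nonempty_fintype ι
  obtain ⟨k, A, hA⟩ := exists_sum_mul_eq_X_pow hF j
  refine ⟨k, ∑ l, A l * G l, fun i ↦ ?_⟩
  rw [← hA, Finset.sum_mul, Finset.sum_mul]
  exact Finset.sum_congr rfl fun l _ ↦ by linear_combination A l * hFG i l

lemma exists_eq_mul_of_mul_comm [Finite ι] [Nontrivial σ] {F G : ι → MvPolynomial σ K}
    (hF : ∀ x : σ → K, x ≠ 0 → (fun i ↦ eval x (F i)) ≠ 0)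
    (hFG : ∀ i j, G i * F j = G j * F i) : ∃ q, ∀ i, G i = q * F i := by
  obtain ⟨a, b, hab⟩ := exists_pair_ne σ
  obtain ⟨k, H, hH⟩ := exists_X_pow_mul_eq_mul hF hFG a
  obtain ⟨l, H', hH'⟩ := exists_X_pow_mul_eq_mul hF hFG b
  obtain ⟨i, hi⟩ : ∃ i, F i ≠ 0 := by
    by_contra! h
    exact hF 1 one_ne_zero (funext fun i ↦ by simp [h i])
  have H_mul_X_pow : H * X b ^ l = X a ^ k * H' :=
    mul_right_cancel₀ hi (by linear_combination X a ^ k * hH' i - X b ^ l * hH i)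
  obtain ⟨q, rfl⟩ : X a ^ k ∣ H :=
    (isRelPrime_X_pow_X_pow hab k l).dvd_of_dvd_mul_right ⟨H', H_mul_X_pow⟩
  exact ⟨q, fun i ↦ mul_left_cancel₀ (pow_ne_zero k (X_ne_zero a)) (by rw [hH i, mul_assoc])⟩

end CommonZeros

section Homogeneous

variable {R σ : Type*} {d : ℕ}

lemma eval_smul_of_isHomogeneous [CommSemiring R] {p : MvPolynomial σ R} (hp : p.IsHomogeneous d)
    (c : R) (x : σ → R) : eval (c • x) p = c ^ d * eval x p := by
  rw [eval_eq, eval_eq, Finset.mul_sum]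
  refine Finset.sum_congr rfl fun m hm ↦ ?_
  simp only [Pi.smul_apply, smul_eq_mul, mul_pow, Finset.prod_mul_distrib,
    Finset.prod_pow_eq_pow_sum, ← hp.degree_eq_sum_deg_support hm]
  ring

lemma exists_eq_C_of_isHomogeneous_mul [CommRing R] [IsDomain R] {p q : MvPolynomial σ R}
    (hp : p.IsHomogeneous d) (hqp : (q * p).IsHomogeneous d) (h : q * p ≠ 0) :
    ∃ c, q = C c := by
  have hdeg : q.totalDegree + d = d := by
    have := totalDegree_mul_of_isDomain (left_ne_zero_of_mul h) (right_ne_zero_of_mul h)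
    rwa [hqp.totalDegree h, hp.totalDegree (right_ne_zero_of_mul h), eq_comm] at this
  exact ⟨_, totalDegree_eq_zero_iff_eq_C.mp (by lia)⟩

end Homogeneous

section Norms

variable {R σ : Type*} [NormedCommRing R] [NormOneClass R] [Fintype σ] {x y : σ → R}

lemma norm_prod_le_one {ι : Type*} (s : Finset ι) {f : ι → R} (hf : ∀ i ∈ s, ‖f i‖ ≤ 1) :
    ‖∏ i ∈ s, f i‖ ≤ 1 :=
  (s.norm_prod_le f).trans (Finset.prod_le_one (fun _ _ ↦ norm_nonneg _) hf)

lemma norm_pow_le_one {a : R} (ha : ‖a‖ ≤ 1) (n : ℕ) : ‖a ^ n‖ ≤ 1 :=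
  (norm_pow_le a n).trans (pow_le_one₀ (norm_nonneg _) ha)

lemma norm_monomial_le_one (hx : ‖x‖ ≤ 1) (m : σ →₀ ℕ) : ‖∏ i, x i ^ m i‖ ≤ 1 :=
  norm_prod_le_one _ fun i _ ↦ norm_pow_le_one ((norm_le_pi_norm x i).trans hx) _

lemma exists_forall_norm_eval_le (p : MvPolynomial σ R) :
    ∃ B : ℝ, ∀ x : σ → R, ‖x‖ ≤ 1 → ‖eval x p‖ ≤ B := by
  refine ⟨∑ m ∈ p.support, ‖p.coeff m‖, fun x hx ↦ ?_⟩
  rw [eval_eq']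
  refine (norm_sum_le _ _).trans (Finset.sum_le_sum fun m _ ↦ (norm_mul_le _ _).trans ?_)
  exact mul_le_of_le_one_right (norm_nonneg _) (norm_monomial_le_one hx m)

lemma exists_forall_one_le_mul_norm_eval {K ι : Type*} [NormedField K] [IsAlgClosed K] [Nonempty σ]
    [Fintype ι] {F : ι → MvPolynomial σ K}
    (hF : ∀ x : σ → K, x ≠ 0 → (fun i ↦ eval x (F i)) ≠ 0) :
    ∃ B : ℝ, ∀ x : σ → K, ‖x‖ = 1 → 1 ≤ B * ‖fun i ↦ eval x (F i)‖ := by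
  choose k G hG using exists_sum_mul_eq_X_pow hF
  choose C hC using fun j i ↦ exists_forall_norm_eval_le (G j i)
  obtain ⟨B, hB⟩ := (Set.finite_range fun j ↦ ∑ i, C j i).bddAbove
  refine ⟨B, fun x hx ↦ ?_⟩
  obtain ⟨j, hj⟩ := (IsGreatest.pi_norm x).1
  have eval_X_pow : ∑ i, eval x (G j i) * eval x (F i) = x j ^ k j := by
    simpa using congrArg (eval x) (hG j)
  calc (1 : ℝ) = ‖∑ i, eval x (G j i) * eval x (F i)‖ := by
        rw [eval_X_pow, norm_pow, show ‖x j‖ = 1 from hj.trans hx, one_pow]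
    _ ≤ ∑ i, C j i * ‖fun i ↦ eval x (F i)‖ := by
        refine norm_sum_le_of_le _ fun i _ ↦ (norm_mul_le _ _).trans ?_
        exact mul_le_mul (hC j i x hx.le) (norm_le_pi_norm (fun i ↦ eval x (F i)) i)
          (norm_nonneg _) ((norm_nonneg _).trans (hC j i x hx.le))
    _ = (∑ i, C j i) * ‖fun i ↦ eval x (F i)‖ := by rw [Finset.sum_mul]
    _ ≤ B * ‖fun i ↦ eval x (F i)‖ :=
        mul_le_mul_of_nonneg_right (hB ⟨j, rfl⟩) (norm_nonneg _)

variable [IsUltrametricDist R]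

lemma norm_eval_le_one {p : MvPolynomial σ R} (hp : ∀ m, ‖p.coeff m‖ ≤ 1) (hx : ‖x‖ ≤ 1) :
    ‖eval x p‖ ≤ 1 := by
  rw [eval_eq']
  refine IsUltrametricDist.norm_sum_le_of_forall_le_of_nonneg zero_le_one fun m _ ↦ ?_
  exact (norm_mul_le _ _).trans
    (mul_le_one₀ (hp m) (norm_nonneg _) (norm_monomial_le_one hx m))

lemma norm_prod_sub_prod_le {ι : Type*} (s : Finset ι) {f g : ι → R} {δ : ℝ} (hδ : 0 ≤ δ)
    (hf : ∀ i ∈ s, ‖f i‖ ≤ 1) (hg : ∀ i ∈ s, ‖g i‖ ≤ 1) (hfg : ∀ i ∈ s, ‖f i - g i‖ ≤ δ) :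
    ‖∏ i ∈ s, f i - ∏ i ∈ s, g i‖ ≤ δ := by
  induction s using Finset.cons_induction with
  | empty => simpa using hδ
  | cons i s hi ih =>
    simp only [Finset.forall_mem_cons] at hf hg hfg
    have split : ∏ j ∈ s.cons i hi, f j - ∏ j ∈ s.cons i hi, g j
        = (f i - g i) * ∏ j ∈ s, f j + g i * (∏ j ∈ s, f j - ∏ j ∈ s, g j) := by
      rw [Finset.prod_cons, Finset.prod_cons]
      ring
    rw [split]
    refine (IsUltrametricDist.norm_add_le_max _ _).trans (max_le ?_ ?_) <;>
      refine (norm_mul_le _ _).trans ?_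
    · exact (mul_le_of_le_one_right (norm_nonneg _) (norm_prod_le_one s hf.2)).trans hfg.1
    · exact (mul_le_of_le_one_left (norm_nonneg _) hg.1).trans (ih hf.2 hg.2 hfg.2)

lemma norm_pow_sub_pow_le {a b : R} (ha : ‖a‖ ≤ 1) (hb : ‖b‖ ≤ 1) (n : ℕ) :
    ‖a ^ n - b ^ n‖ ≤ ‖a - b‖ := by
  simpa using norm_prod_sub_prod_le (Finset.range n) (norm_nonneg (a - b))
    (fun _ _ ↦ ha) (fun _ _ ↦ hb) fun _ _ ↦ le_rfl

lemma norm_eval_sub_eval_le {p : MvPolynomial σ R} (hp : ∀ m, ‖p.coeff m‖ ≤ 1)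
    (hx : ‖x‖ ≤ 1) (hy : ‖y‖ ≤ 1) : ‖eval x p - eval y p‖ ≤ ‖x - y‖ := by
  have hx' i : ‖x i‖ ≤ 1 := (norm_le_pi_norm x i).trans hx
  have hy' i : ‖y i‖ ≤ 1 := (norm_le_pi_norm y i).trans hy
  have monomial_sub_le (m : σ →₀ ℕ) : ‖∏ i, x i ^ m i - ∏ i, y i ^ m i‖ ≤ ‖x - y‖ :=
    norm_prod_sub_prod_le _ (norm_nonneg _) (fun i _ ↦ norm_pow_le_one (hx' i) _)
      (fun i _ ↦ norm_pow_le_one (hy' i) _)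
      fun i _ ↦ (norm_pow_sub_pow_le (hx' i) (hy' i) _).trans (norm_le_pi_norm (x - y) i)
  rw [eval_eq', eval_eq', ← Finset.sum_sub_distrib]
  refine IsUltrametricDist.norm_sum_le_of_forall_le_of_nonneg (norm_nonneg _) fun m _ ↦ ?_
  rw [← mul_sub]
  exact (norm_mul_le _ _).trans
    ((mul_le_of_le_one_left (norm_nonneg _) (hp m)).trans (monomial_sub_le m))

end Norms

variable {K : Type*} {N d : ℕ}

section Lifts

variable [Field K] {Φ Ψ : PolyMap K N} {f : PSpace K N → PSpace K N}

lemma PolyMap.app_smul (hΦ : ∀ i, (Φ i).IsHomogeneous d) (c : K) (x : Fin (N + 1) → K) :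
    Φ.app (c • x) = c ^ d • Φ.app x :=
  funext fun i ↦ eval_smul_of_isHomogeneous (hΦ i) c x

lemma mk_smul {c : K} (hc : c ≠ 0) {x : Fin (N + 1) → K} (hx : x ≠ 0) :
    Projectivization.mk K (c • x) (smul_ne_zero hc hx) = Projectivization.mk K x hx :=
  (Projectivization.mk_eq_mk_iff' K _ _ _ _).mpr ⟨c, rfl⟩

lemma IsLift.iterate_app_ne_zero (hΦ : IsLift d Φ f) {x : Fin (N + 1) → K} (hx : x ≠ 0) (n : ℕ) :
    Φ.app^[n] x ≠ 0 := by
  induction n with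
  | zero => exact hx
  | succ n ih =>
    rw [Function.iterate_succ_apply']
    exact hΦ.app_ne_zero _ ih

lemma IsLift.iterate_mk (hΦ : IsLift d Φ f) {x : Fin (N + 1) → K} (hx : x ≠ 0) (n : ℕ) :
    f^[n] (Projectivization.mk K x hx)
      = Projectivization.mk K (Φ.app^[n] x) (hΦ.iterate_app_ne_zero hx n) := by
  induction n with
  | zero => rfl
  | succ n ih => simp only [Function.iterate_succ_apply', ih, hΦ.map_mk]

lemma IsLift.exists_smul_app_eq (hΦ : IsLift d Φ f) (hΨ : IsLift d Ψ f) {x : Fin (N + 1) → K}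
    (hx : x ≠ 0) : ∃ c : K, c • Φ.app x = Ψ.app x :=
  (Projectivization.mk_eq_mk_iff' K _ _ _ _).mp ((hΨ.map_mk x hx).symm.trans (hΦ.map_mk x hx))

lemma IsLift.apply_mul_apply_comm [Infinite K] (hΦ : IsLift d Φ f) (hΨ : IsLift d Ψ f)
    (i j : Fin (N + 1)) : Ψ i * Φ j = Ψ j * Φ i := by
  refine funext_set (fun _ ↦ {0}ᶜ) (fun _ ↦ (Set.finite_singleton 0).infinite_compl) fun x hx ↦ ?_
  have hx0 : x ≠ 0 := fun h ↦ hx 0 trivial (congrFun h 0)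
  obtain ⟨c, hc⟩ := hΦ.exists_smul_app_eq hΨ hx0
  have hc' i : eval x (Ψ i) = c * eval x (Φ i) := (congrFun hc i).symm
  rw [map_mul, map_mul, hc', hc']
  ring

variable [IsAlgClosed K]

lemma IsLift.exists_eq_C_mul_of_zero {Φ Ψ : PolyMap K 0} {f : PSpace K 0 → PSpace K 0}
    (hΦ : IsLift d Φ f) (hΨ : IsLift d Ψ f) : ∃ c : K, ∀ i, Ψ i = C c * Φ i := by
  have : Infinite K := IsAlgClosed.instInfinite
  obtain ⟨c, hc⟩ := hΦ.exists_smul_app_eq hΨ (x := 1) one_ne_zero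
  refine ⟨c, fun i ↦ MvPolynomial.funext fun x ↦ ?_⟩
  have hx : x = x 0 • 1 := by
    ext j
    simp [Fin.fin_one_eq_zero j]
  have hi : eval 1 (Ψ i) = c * eval 1 (Φ i) := (congrFun hc i).symm
  rw [hx, eval_smul_of_isHomogeneous (hΨ.homogeneous i), hi, map_mul, eval_C,
    eval_smul_of_isHomogeneous (hΦ.homogeneous i)]
  ring

lemma IsLift.exists_eq_C_mul (hΦ : IsLift d Φ f) (hΨ : IsLift d Ψ f) :
    ∃ c : K, ∀ i, Ψ i = C c * Φ i := by
  have : Infinite K := IsAlgClosed.instInfinite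
  rcases N with - | N
  · exact hΦ.exists_eq_C_mul_of_zero hΨ
  obtain ⟨q, hq⟩ := exists_eq_mul_of_mul_comm hΦ.app_ne_zero (hΦ.apply_mul_apply_comm hΨ)
  obtain ⟨i, hi⟩ : ∃ i, Ψ i ≠ 0 := by
    by_contra! h
    exact hΨ.app_ne_zero 1 one_ne_zero (funext fun i ↦ by simp [PolyMap.app, h i])
  obtain ⟨c, rfl⟩ := exists_eq_C_of_isHomogeneous_mul (hΦ.homogeneous i)
    (hq i ▸ hΨ.homogeneous i) (hq i ▸ hi)
  exact ⟨c, hq⟩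

end Lifts

section ReductionDefect

variable [NormedField K] {Φ : PolyMap K N} {f : PSpace K N → PSpace K N}

lemma exists_mk_eq_of_norm_rep_apply {P : PSpace K N} {j : Fin (N + 1)}
    (hj : ‖P.rep j‖ = ‖P.rep‖) :
    ∃ (x : Fin (N + 1) → K) (hx : x ≠ 0), Projectivization.mk K x hx = P ∧ ‖x‖ = 1 ∧ x j = 1 := by
  have norm_ne_zero : ‖P.rep j‖ ≠ 0 := hj ▸ norm_ne_zero_iff.mpr P.rep_nonzero
  have apply_ne_zero : P.rep j ≠ 0 := norm_ne_zero_iff.mp norm_ne_zero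
  refine ⟨(P.rep j)⁻¹ • P.rep, smul_ne_zero (inv_ne_zero apply_ne_zero) P.rep_nonzero, ?_, ?_, ?_⟩
  · rw [mk_smul (inv_ne_zero apply_ne_zero) P.rep_nonzero, P.mk_rep]
  · rw [norm_smul, norm_inv, ← hj, inv_mul_cancel₀ norm_ne_zero]
  · exact inv_mul_cancel₀ apply_ne_zero

lemma exists_mk_eq_norm_eq_one (P : PSpace K N) :
    ∃ (x : Fin (N + 1) → K) (hx : x ≠ 0), Projectivization.mk K x hx = P ∧ ‖x‖ = 1 := by
  obtain ⟨j, hj⟩ := (IsGreatest.pi_norm P.rep).1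
  obtain ⟨x, hx, hP, hx1, -⟩ := exists_mk_eq_of_norm_rep_apply hj
  exact ⟨x, hx, hP, hx1⟩

/-- The number `d log ‖x‖ - log ‖Φ(x)‖` for a lift `x` of `P`. When `Φ` is a minimal lift of a
morphism, it measures how far the morphism is from having good reduction at `P`. -/
noncomputable def reductionDefect (d : ℕ) (Φ : PolyMap K N) (P : PSpace K N) : ℝ :=
  d * Real.log ‖P.rep‖ - Real.log ‖Φ.app P.rep‖

lemma IsLift.reductionDefect_mk (hΦ : IsLift d Φ f) {x : Fin (N + 1) → K} (hx : x ≠ 0) :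
    reductionDefect d Φ (Projectivization.mk K x hx)
      = d * Real.log ‖x‖ - Real.log ‖Φ.app x‖ := by
  obtain ⟨a, ha⟩ := Projectivization.exists_smul_eq_mk_rep K x hx
  rw [reductionDefect, ← ha, Units.smul_def, PolyMap.app_smul hΦ.homogeneous, norm_smul, norm_smul,
    norm_pow, Real.log_mul (by simp) (norm_ne_zero_iff.mpr hx),
    Real.log_mul (by simp) (norm_ne_zero_iff.mpr (hΦ.app_ne_zero x hx)), Real.log_pow]
  ring

lemma IsLift.reductionDefect_mk_of_norm_eq_one (hΦ : IsLift d Φ f) {x : Fin (N + 1) → K}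
    (hx : x ≠ 0) (hx1 : ‖x‖ = 1) :
    reductionDefect d Φ (Projectivization.mk K x hx) = -Real.log ‖Φ.app x‖ := by
  rw [hΦ.reductionDefect_mk, hx1, Real.log_one, mul_zero, zero_sub]

lemma PolyMap.exists_forall_norm_app_le (Φ : PolyMap K N) :
    ∃ B : ℝ, ∀ x : Fin (N + 1) → K, ‖x‖ ≤ 1 → ‖Φ.app x‖ ≤ B := by
  choose B hB using fun i ↦ exists_forall_norm_eval_le (Φ i)
  obtain ⟨M, hM⟩ := (Set.finite_range B).bddAbove
  exact ⟨M, fun x hx ↦ (pi_norm_le_iff_of_nonempty _).mpr fun i ↦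
    (hB i x hx).trans (hM ⟨i, rfl⟩)⟩

lemma IsLift.log_norm_iterate_div (hd : d ≠ 0) (hΦ : IsLift d Φ f) {x : Fin (N + 1) → K}
    (hx : x ≠ 0) (n : ℕ) :
    Real.log ‖Φ.app^[n] x‖ / (d : ℝ) ^ n = Real.log ‖x‖
      - ∑ k ∈ Finset.range n,
          reductionDefect d Φ (f^[k] (Projectivization.mk K x hx)) / (d : ℝ) ^ (k + 1) := by
  induction n with
  | zero => simp
  | succ n ih =>
    rw [Finset.sum_range_succ, ← sub_sub, ← ih, hΦ.iterate_mk hx, hΦ.reductionDefect_mk,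
      Function.iterate_succ_apply']
    field_simp
    ring

variable [IsAlgClosed K]

lemma IsLift.exists_forall_abs_reductionDefect_le (hΦ : IsLift d Φ f) :
    ∃ C : ℝ, ∀ P, |reductionDefect d Φ P| ≤ C := by
  obtain ⟨A, hA⟩ := exists_forall_one_le_mul_norm_eval hΦ.app_ne_zero
  obtain ⟨B, hB⟩ := Φ.exists_forall_norm_app_le
  refine ⟨max (Real.log A) (Real.log B), fun P ↦ ?_⟩
  obtain ⟨x, hx, rfl, hx1⟩ := exists_mk_eq_norm_eq_one P
  have hpos : 0 < ‖Φ.app x‖ := norm_pos_iff.mpr (hΦ.app_ne_zero x hx)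
  have one_le : 1 ≤ A * ‖Φ.app x‖ := hA x hx1
  have A_pos : 0 < A := pos_of_mul_pos_left (one_pos.trans_le one_le) hpos.le
  have lower : 0 ≤ Real.log A + Real.log ‖Φ.app x‖ :=
    Real.log_mul A_pos.ne' hpos.ne' ▸ Real.log_nonneg one_le
  have upper : Real.log ‖Φ.app x‖ ≤ Real.log B := Real.log_le_log hpos (hB x hx1.le)
  rw [hΦ.reductionDefect_mk_of_norm_eq_one hx hx1, abs_neg]
  exact abs_le'.mpr ⟨upper.trans (le_max_right _ _),
    (neg_le_iff_add_nonneg.mpr lower).trans (le_max_left _ _)⟩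

lemma IsLift.summable_reductionDefect (hd : 2 ≤ d) (hΦ : IsLift d Φ f) (P : PSpace K N) :
    Summable fun n : ℕ ↦ reductionDefect d Φ (f^[n] P) / (d : ℝ) ^ (n + 1) := by
  obtain ⟨C, hC⟩ := hΦ.exists_forall_abs_reductionDefect_le
  have inv_lt_one : (d : ℝ)⁻¹ < 1 := inv_lt_one_of_one_lt₀ (by exact_mod_cast hd)
  refine .of_norm_bounded (g := fun n ↦ C * (d : ℝ)⁻¹ ^ (n + 1)) ?_ fun n ↦ ?_
  · exact ((summable_nat_add_iff 1).mpr
      (summable_geometric_of_lt_one (by positivity) inv_lt_one)).mul_left C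
  · rw [norm_div, norm_pow, Real.norm_natCast, inv_pow, ← div_eq_mul_inv]
    exact div_le_div_of_nonneg_right (hC _) (by positivity)

lemma IsLift.tendsto_log_norm_iterate_div (hd : 2 ≤ d) (hΦ : IsLift d Φ f)
    {x : Fin (N + 1) → K} (hx : x ≠ 0) :
    Tendsto (fun n : ℕ ↦ Real.log ‖Φ.app^[n] x‖ / (d : ℝ) ^ n) atTop
      (𝓝 (Real.log ‖x‖ - ∑' n : ℕ,
        reductionDefect d Φ (f^[n] (Projectivization.mk K x hx)) / (d : ℝ) ^ (n + 1))) := by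
  simp only [hΦ.log_norm_iterate_div (by lia) hx]
  exact (hΦ.summable_reductionDefect hd _).hasSum.tendsto_sum_nat.const_sub _

lemma IsLift.modifiedGreen_eq_neg_tsum (hd : 2 ≤ d) (hΦ : IsLift d Φ f) (P : PSpace K N) :
    modifiedGreen d Φ P
      = -∑' n : ℕ, reductionDefect d Φ (f^[n] P) / (d : ℝ) ^ (n + 1) := by
  rw [modifiedGreen, greenFunction,
    (hΦ.tendsto_log_norm_iterate_div hd P.rep_nonzero).limUnder_eq, P.mk_rep]
  ring

lemma IsLift.tendsto_modifiedGreen_add_log (hd : 2 ≤ d) (hΦ : IsLift d Φ f)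
    {x : Fin (N + 1) → K} (hx : x ≠ 0) :
    Tendsto (fun n : ℕ ↦ Real.log ‖Φ.app^[n] x‖ / (d : ℝ) ^ n) atTop
      (𝓝 (modifiedGreen d Φ (Projectivization.mk K x hx) + Real.log ‖x‖)) := by
  rw [hΦ.modifiedGreen_eq_neg_tsum hd, neg_add_eq_sub]
  exact hΦ.tendsto_log_norm_iterate_div hd hx

end ReductionDefect

section GoodReduction

variable [NormedField K] {φ : ProjMorphism K N d} {Φ Ψ : PolyMap K N}

lemma PolyMap.norm_coeff_le_coeffNorm (Φ : PolyMap K N) (i : Fin (N + 1))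
    (m : Fin (N + 1) →₀ ℕ) : ‖(Φ i).coeff m‖ ≤ Φ.coeffNorm := by
  by_cases hm : m ∈ (Φ i).support
  · have h : ‖(Φ i).coeff m‖₊ ≤ (Φ i).support.sup fun m ↦ ‖(Φ i).coeff m‖₊ :=
      Finset.le_sup (f := fun m ↦ ‖(Φ i).coeff m‖₊) hm
    exact h.trans (Finset.le_sup (f := fun i ↦ (Φ i).support.sup fun m ↦ ‖(Φ i).coeff m‖₊)
      (Finset.mem_univ i))
  · rw [notMem_support_iff.mp hm, norm_zero]
    exact NNReal.coe_nonneg _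

lemma PolyMap.exists_norm_coeff_eq_coeffNorm (Φ : PolyMap K N) :
    ∃ i m, ‖(Φ i).coeff m‖ = Φ.coeffNorm := by
  obtain ⟨i, -, hi⟩ := Finset.exists_mem_eq_sup Finset.univ Finset.univ_nonempty
    fun i ↦ (Φ i).support.sup fun m ↦ ‖(Φ i).coeff m‖₊
  rcases (Φ i).support.eq_empty_or_nonempty with hempty | hne
  · refine ⟨i, 0, ?_⟩
    rw [PolyMap.coeffNorm, hi, hempty, support_eq_empty.mp hempty]
    simp
  · obtain ⟨m, -, hm⟩ := Finset.exists_mem_eq_sup _ hne fun m ↦ ‖(Φ i).coeff m‖₊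
    exact ⟨i, m, by rw [PolyMap.coeffNorm, hi, hm, coe_nnnorm]⟩

lemma isMinimalLift_iff_coeffNorm_eq_one :
    IsMinimalLift φ Φ ↔ IsLift d Φ φ ∧ Φ.coeffNorm = 1 := by
  constructor
  · rintro ⟨hlift, hle, i, m, him⟩
    obtain ⟨j, l, hjl⟩ := Φ.exists_norm_coeff_eq_coeffNorm
    exact ⟨hlift, le_antisymm (hjl ▸ hle j l) (him ▸ Φ.norm_coeff_le_coeffNorm i m)⟩
  · rintro ⟨hlift, h1⟩
    exact ⟨hlift, h1 ▸ Φ.norm_coeff_le_coeffNorm, h1 ▸ Φ.exists_norm_coeff_eq_coeffNorm⟩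

variable [IsAlgClosed K]

lemma IsMinimalLift.norm_app_eq (hΦ : IsMinimalLift φ Φ) (hΨ : IsMinimalLift φ Ψ)
    (x : Fin (N + 1) → K) : ‖Ψ.app x‖ = ‖Φ.app x‖ := by
  obtain ⟨c, hc⟩ := hΦ.isLift.exists_eq_C_mul hΨ.isLift
  have norm_coeff i m : ‖(Ψ i).coeff m‖ = ‖c‖ * ‖(Φ i).coeff m‖ := by
    rw [hc, coeff_C_mul, norm_mul]
  obtain ⟨i, m, him⟩ := hΦ.exists_unit
  obtain ⟨j, l, hjl⟩ := hΨ.exists_unit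
  have norm_c : ‖c‖ = 1 := by
    refine le_antisymm ?_ ?_
    · simpa [norm_coeff, him] using hΨ.integral i m
    · rw [← hjl, norm_coeff]
      exact mul_le_of_le_one_right (norm_nonneg c) (hΦ.integral j l)
  have app_eq : Ψ.app x = c • Φ.app x := funext fun i ↦ by simp [PolyMap.app, hc]
  rw [app_eq, norm_smul, norm_c, one_mul]

lemma IsMinimalLift.mk_mem_goodSet_iff (hΦ : IsMinimalLift φ Φ) {x : Fin (N + 1) → K}
    (hx : x ≠ 0) (hx1 : ‖x‖ = 1) :
    Projectivization.mk K x hx ∈ goodSet φ ↔ ‖Φ.app x‖ = 1 := by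
  constructor
  · rintro ⟨Ψ, y, hy, hΨ, hyx, hy1, hΨ1, hΨy⟩
    have hΨmin := isMinimalLift_iff_coeffNorm_eq_one.mpr ⟨hΨ, hΨ1⟩
    obtain ⟨a, rfl⟩ := (Projectivization.mk_eq_mk_iff' K _ _ _ _).mp hyx.symm
    have norm_a : ‖a‖ = 1 := by rwa [norm_smul, hy1, mul_one] at hx1
    rw [PolyMap.app_smul hΦ.isLift.homogeneous, norm_smul, norm_pow, norm_a, one_pow, one_mul,
      ← hΦ.norm_app_eq hΨmin, hΨy]
  · exact fun h ↦
      ⟨Φ, x, hx, hΦ.isLift, rfl, hx1, (isMinimalLift_iff_coeffNorm_eq_one.mp hΦ).2, h⟩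

lemma IsMinimalLift.reductionDefect_eq_zero_iff (hΦ : IsMinimalLift φ Φ) (P : PSpace K N) :
    reductionDefect d Φ P = 0 ↔ P ∈ goodSet φ := by
  obtain ⟨x, hx, rfl, hx1⟩ := exists_mk_eq_norm_eq_one P
  have hpos : 0 < ‖Φ.app x‖ := norm_pos_iff.mpr (hΦ.isLift.app_ne_zero x hx)
  rw [hΦ.isLift.reductionDefect_mk_of_norm_eq_one hx hx1, neg_eq_zero, hΦ.mk_mem_goodSet_iff hx hx1]
  refine ⟨Real.eq_one_of_pos_of_log_eq_zero hpos, fun h ↦ by rw [h, Real.log_one]⟩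

end GoodReduction

section ChordalMetric

variable [NormedField K]

lemma norm_mul_sub_mul_le_chordalVec_mul {x y : Fin (N + 1) → K} (hx : x ≠ 0) (hy : y ≠ 0)
    (i j : Fin (N + 1)) : ‖x i * y j - x j * y i‖ ≤ chordalVec x y * (‖x‖ * ‖y‖) := by
  have hxy : ‖x‖ * ‖y‖ ≠ 0 := mul_ne_zero (norm_ne_zero_iff.mpr hx) (norm_ne_zero_iff.mpr hy)
  rw [chordalVec, div_mul_cancel₀ _ hxy]
  exact norm_le_pi_norm
    (fun p : Fin (N + 1) × Fin (N + 1) ↦ x p.1 * y p.2 - x p.2 * y p.1) (i, j)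

variable [IsUltrametricDist K]

lemma dist_mk {x y : Fin (N + 1) → K} (hx : x ≠ 0) (hy : y ≠ 0) :
    dist (Projectivization.mk K x hx) (Projectivization.mk K y hy) = chordalVec x y :=
  chordalDist_mk x y hx hy

instance instIsUltrametricDistPSpace : IsUltrametricDist (PSpace K N) where
  dist_triangle_max P Q R :=
    chordalVec_triangle P.rep Q.rep R.rep P.rep_nonzero Q.rep_nonzero R.rep_nonzero

lemma chordalVec_le_norm_sub {x y : Fin (N + 1) → K} (hx : ‖x‖ = 1) (hy : ‖y‖ = 1) :
    chordalVec x y ≤ ‖x - y‖ := by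
  rw [chordalVec, hx, hy, mul_one, div_one, pi_norm_le_iff_of_nonneg (norm_nonneg _)]
  rintro ⟨i, j⟩
  have term_le (i j) : ‖(x i - y i) * y j‖ ≤ ‖x - y‖ := by
    rw [norm_mul]
    exact (mul_le_of_le_one_right (norm_nonneg _) (hy ▸ norm_le_pi_norm y j)).trans
      (norm_le_pi_norm (x - y) i)
  calc ‖x i * y j - x j * y i‖ = ‖(x i - y i) * y j + -((x j - y j) * y i)‖ := by ring_nf
    _ ≤ max ‖(x i - y i) * y j‖ ‖(x j - y j) * y i‖ := by
        simpa only [norm_neg] using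
          IsUltrametricDist.norm_add_le_max ((x i - y i) * y j) (-((x j - y j) * y i))
    _ ≤ ‖x - y‖ := max_le (term_le i j) (term_le j i)

lemma norm_apply_eq_of_chordalVec_lt_one {x y : Fin (N + 1) → K} (hx : x ≠ 0) (hy : y ≠ 0)
    (hxy : chordalVec x y < 1) {j : Fin (N + 1)} (hj : ‖x j‖ = ‖x‖) : ‖y j‖ = ‖y‖ := by
  refine (norm_le_pi_norm y j).antisymm (not_lt.mp fun hlt ↦ ?_)
  obtain ⟨i, hi⟩ := (IsGreatest.pi_norm y).1
  have hx' : 0 < ‖x‖ := norm_pos_iff.mpr hx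
  have hy' : 0 < ‖y‖ := norm_pos_iff.mpr hy
  have minor_lt : ‖x j * y i - x i * y j‖ < ‖x‖ * ‖y‖ :=
    (norm_mul_sub_mul_le_chordalVec_mul hx hy j i).trans_lt
      (mul_lt_of_lt_one_left (mul_pos hx' hy') hxy)
  have term_lt : ‖x i * y j‖ < ‖x‖ * ‖y‖ := by
    rw [norm_mul]
    exact (mul_le_mul_of_nonneg_right (norm_le_pi_norm x i) (norm_nonneg _)).trans_lt
      (mul_lt_mul_of_pos_left hlt hx')
  have : ‖x‖ * ‖y‖ < ‖x‖ * ‖y‖ :=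
    calc ‖x‖ * ‖y‖ = ‖(x j * y i - x i * y j) + x i * y j‖ := by
          rw [sub_add_cancel, norm_mul, hj, show ‖y i‖ = ‖y‖ from hi]
      _ ≤ max ‖x j * y i - x i * y j‖ ‖x i * y j‖ := IsUltrametricDist.norm_add_le_max _ _
      _ < ‖x‖ * ‖y‖ := max_lt minor_lt term_lt
  exact this.false

lemma exists_lifts_norm_sub_le_dist {P Q : PSpace K N} (hPQ : dist P Q < 1) :
    ∃ (x y : Fin (N + 1) → K) (hx : x ≠ 0) (hy : y ≠ 0), Projectivization.mk K x hx = P ∧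
      Projectivization.mk K y hy = Q ∧ ‖x‖ = 1 ∧ ‖y‖ = 1 ∧ ‖x - y‖ ≤ dist P Q := by
  obtain ⟨j, hj⟩ := (IsGreatest.pi_norm P.rep).1
  obtain ⟨x, hx, hP, hx1, hxj⟩ := exists_mk_eq_of_norm_rep_apply hj
  obtain ⟨y, hy, hQ, hy1, hyj⟩ := exists_mk_eq_of_norm_rep_apply
    (norm_apply_eq_of_chordalVec_lt_one P.rep_nonzero Q.rep_nonzero hPQ hj)
  refine ⟨x, y, hx, hy, hP, hQ, hx1, hy1, (pi_norm_le_iff_of_nonneg dist_nonneg).mpr fun i ↦ ?_⟩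
  have minor_le := norm_mul_sub_mul_le_chordalVec_mul hx hy i j
  rwa [hxj, hyj, hx1, hy1, mul_one, one_mul, mul_one, mul_one, ← dist_mk hx hy, hP, hQ]
    at minor_le

end ChordalMetric

section MinimalLift

variable [NormedField K] [IsUltrametricDist K] {φ : ProjMorphism K N d} {Φ : PolyMap K N}

lemma PolyMap.norm_res_le_one (hΦ : ∀ i m, ‖(Φ i).coeff m‖ ≤ 1) : ‖Φ.res d‖ ≤ 1 := by
  rw [PolyMap.res, eval₂_eq_eval_map]
  refine norm_eval_le_one (fun m ↦ ?_)
    ((pi_norm_le_iff_of_nonneg zero_le_one).mpr fun c ↦ hΦ c.1 c.2.1)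
  rw [coeff_map]
  exact IsUltrametricDist.norm_intCast_le_one K _

lemma PolyMap.norm_app_le_one (hΦ : ∀ i m, ‖(Φ i).coeff m‖ ≤ 1) {x : Fin (N + 1) → K}
    (hx : ‖x‖ ≤ 1) : ‖Φ.app x‖ ≤ 1 :=
  (pi_norm_le_iff_of_nonneg zero_le_one).mpr fun i ↦ norm_eval_le_one (hΦ i) hx

lemma PolyMap.norm_app_sub_app_le (hΦ : ∀ i m, ‖(Φ i).coeff m‖ ≤ 1) {x y : Fin (N + 1) → K}
    (hx : ‖x‖ ≤ 1) (hy : ‖y‖ ≤ 1) : ‖Φ.app x - Φ.app y‖ ≤ ‖x - y‖ :=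
  (pi_norm_le_iff_of_nonneg (norm_nonneg _)).mpr fun i ↦ norm_eval_sub_eval_le (hΦ i) hx hy

lemma IsMinimalLift.reductionDefect_nonneg (hΦ : IsMinimalLift φ Φ) (P : PSpace K N) :
    0 ≤ reductionDefect d Φ P := by
  obtain ⟨x, hx, rfl, hx1⟩ := exists_mk_eq_norm_eq_one P
  rw [hΦ.isLift.reductionDefect_mk_of_norm_eq_one hx hx1, neg_nonneg]
  exact Real.log_nonpos (norm_nonneg _) (PolyMap.norm_app_le_one hΦ.integral hx1.le)

variable [IsAlgClosed K]

lemma IsMinimalLift.modifiedGreen_nonpos (hd : 2 ≤ d) (hΦ : IsMinimalLift φ Φ)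
    (P : PSpace K N) : modifiedGreen d Φ P ≤ 0 := by
  rw [hΦ.isLift.modifiedGreen_eq_neg_tsum hd, neg_nonpos]
  exact tsum_nonneg fun n ↦ div_nonneg (hΦ.reductionDefect_nonneg _) (by positivity)

lemma IsMinimalLift.modifiedGreen_eq_zero_iff (hd : 2 ≤ d) (hΦ : IsMinimalLift φ Φ)
    (P : PSpace K N) : modifiedGreen d Φ P = 0 ↔ P ∈ orbitalGoodSet φ := by
  have term_nonneg (n : ℕ) : 0 ≤ reductionDefect d Φ (φ^[n] P) / (d : ℝ) ^ (n + 1) :=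
    div_nonneg (hΦ.reductionDefect_nonneg _) (by positivity)
  have term_eq_zero_iff (n : ℕ) :
      reductionDefect d Φ (φ^[n] P) / (d : ℝ) ^ (n + 1) = 0 ↔ φ^[n] P ∈ goodSet φ := by
    rw [div_eq_zero_iff, or_iff_left (by positivity), hΦ.reductionDefect_eq_zero_iff]
  rw [hΦ.isLift.modifiedGreen_eq_neg_tsum hd, neg_eq_zero,
    ← (hΦ.isLift.summable_reductionDefect hd P).hasSum_iff, hasSum_zero_iff_of_nonneg term_nonneg,
    funext_iff]
  exact forall_congr' term_eq_zero_iff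

lemma IsMinimalLift.modifiedGreen_neg (hd : 2 ≤ d) (hΦ : IsMinimalLift φ Φ) {P : PSpace K N}
    (hP : P ∈ badSet φ) : modifiedGreen d Φ P < 0 :=
  (hΦ.modifiedGreen_nonpos hd P).lt_of_ne fun h ↦
    hP ((hΦ.modifiedGreen_eq_zero_iff hd P).mp h 0)

lemma IsMinimalLift.mem_goodSet_and_dist_map_le (hΦ : IsMinimalLift φ Φ) {P Q : PSpace K N}
    (hP : P ∈ goodSet φ) (hPQ : dist P Q < 1) :
    Q ∈ goodSet φ ∧ dist (φ P) (φ Q) ≤ dist P Q := by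
  obtain ⟨x, y, hx, hy, rfl, rfl, hx1, hy1, hxy⟩ := exists_lifts_norm_sub_le_dist hPQ
  have app_sub_le := (PolyMap.norm_app_sub_app_le hΦ.integral hx1.le hy1.le).trans hxy
  have norm_app_x : ‖Φ.app x‖ = 1 := (hΦ.mk_mem_goodSet_iff hx hx1).mp hP
  have norm_app_y : ‖Φ.app y‖ = 1 := by
    refine (PolyMap.norm_app_le_one hΦ.integral hy1.le).antisymm (not_lt.mp fun hlt ↦ ?_)
    have : ‖Φ.app x‖ < 1 := by
      rw [← sub_add_cancel (Φ.app x) (Φ.app y)]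
      exact (IsUltrametricDist.norm_add_le_max _ _).trans_lt
        (max_lt (app_sub_le.trans_lt hPQ) hlt)
    exact this.ne norm_app_x
  refine ⟨(hΦ.mk_mem_goodSet_iff hy hy1).mpr norm_app_y, ?_⟩
  rw [hΦ.isLift.map_mk, hΦ.isLift.map_mk, dist_mk]
  exact (chordalVec_le_norm_sub norm_app_x norm_app_y).trans app_sub_le

lemma IsMinimalLift.dist_iterate_le_of_dist_lt_one (hΦ : IsMinimalLift φ Φ) {P Q : PSpace K N}
    (hP : P ∈ orbitalGoodSet φ) (hPQ : dist P Q < 1) (n : ℕ) :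
    dist (φ^[n] P) (φ^[n] Q) ≤ dist P Q := by
  induction n with
  | zero => exact le_rfl
  | succ n ih =>
    rw [Function.iterate_succ_apply', Function.iterate_succ_apply']
    exact (hΦ.mem_goodSet_and_dist_map_le (hP n) (ih.trans_lt hPQ)).2.trans ih

lemma IsMinimalLift.ball_subset_orbitalGoodSet (hΦ : IsMinimalLift φ Φ) {P : PSpace K N}
    (hP : P ∈ orbitalGoodSet φ) : Metric.ball P 1 ⊆ orbitalGoodSet φ := fun Q hQ n ↦ by
  have hPQ : dist P Q < 1 := Metric.mem_ball'.mp hQ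
  exact (hΦ.mem_goodSet_and_dist_map_le (hP n)
    ((hΦ.dist_iterate_le_of_dist_lt_one hP hPQ n).trans_lt hPQ)).1

lemma IsMinimalLift.dist_iterate_le (hΦ : IsMinimalLift φ Φ) {P Q R : PSpace K N}
    (hP : P ∈ orbitalGoodSet φ) (hQ : Q ∈ Metric.ball P 1) (hR : R ∈ Metric.ball P 1) (n : ℕ) :
    dist (φ^[n] Q) (φ^[n] R) ≤ dist Q R :=
  hΦ.dist_iterate_le_of_dist_lt_one (hΦ.ball_subset_orbitalGoodSet hP hQ)
    ((dist_triangle_max Q P R).trans_lt (max_lt hQ (Metric.mem_ball'.mp hR))) n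

lemma IsMinimalLift.isOpen_orbitalGoodSet (hΦ : IsMinimalLift φ Φ) : IsOpen (orbitalGoodSet φ) :=
  Metric.isOpen_iff.mpr fun _ hP ↦ ⟨1, one_pos, hΦ.ball_subset_orbitalGoodSet hP⟩

lemma IsMinimalLift.orbitalGoodSet_subset_fatouSet (hΦ : IsMinimalLift φ Φ) :
    orbitalGoodSet φ ⊆ fatouSet φ := by
  refine Set.subset_sUnion_of_mem ⟨hΦ.isOpen_orbitalGoodSet, fun P hP ↦ ?_⟩
  refine Metric.equicontinuousAt_iff.mpr fun ε hε ↦ ⟨min ε 1, lt_min hε one_pos, fun Q hQ n ↦ ?_⟩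
  rw [dist_comm, lt_min_iff] at hQ
  exact (hΦ.dist_iterate_le_of_dist_lt_one hP hQ.2 n).trans_lt hQ.1

end MinimalLift

end ProjDyn

theorem proposition32_general {K : Type*} [NormedField K] [IsUltrametricDist K] [IsAlgClosed K]
    {N d : ℕ} (hd : 2 ≤ d) (φ : ProjDyn.ProjMorphism K N d) (Φ : ProjDyn.PolyMap K N)
    (hΦ : ProjDyn.IsMinimalLift φ Φ) :
    (∀ (x : Fin (N + 1) → K) (hx : x ≠ 0),
      Tendsto (fun n : ℕ => Real.log ‖Φ.app^[n] x‖ / (d : ℝ) ^ n) atTop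
        (𝓝 (ProjDyn.modifiedGreen d Φ (Projectivization.mk K x hx) + Real.log ‖x‖))) ∧
    (∀ P ∈ ProjDyn.orbitalGoodSet φ, ∀ Q ∈ Metric.ball P 1, ∀ R ∈ Metric.ball P 1, ∀ n : ℕ,
        dist (φ^[n] Q) (φ^[n] R) ≤ dist Q R) ∧
    ((∀ P ∈ ProjDyn.orbitalGoodSet φ, Metric.ball P 1 ⊆ ProjDyn.orbitalGoodSet φ) ∧
      IsOpen (ProjDyn.orbitalGoodSet φ)) ∧
    (ProjDyn.orbitalGoodSet φ = {P | ProjDyn.modifiedGreen d Φ P = 0} ∧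
      ProjDyn.orbitalGoodSet φ ⊆ ProjDyn.fatouSet φ) ∧
    (∀ P ∈ ProjDyn.badSet φ, ProjDyn.modifiedGreen d Φ P < 0) ∧
    IsOpen {P | ProjDyn.modifiedGreen d Φ P = 0} := by
  have green_zero_set : ProjDyn.orbitalGoodSet φ = {P | ProjDyn.modifiedGreen d Φ P = 0} :=
    Set.ext fun P ↦ (hΦ.modifiedGreen_eq_zero_iff hd P).symm
  exact ⟨fun x hx ↦ hΦ.isLift.tendsto_modifiedGreen_add_log hd hx,
    fun P hP Q hQ R hR n ↦ hΦ.dist_iterate_le hP hQ hR n,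
    ⟨fun P hP ↦ hΦ.ball_subset_orbitalGoodSet hP, hΦ.isOpen_orbitalGoodSet⟩,
    ⟨green_zero_set, hΦ.orbitalGoodSet_subset_fatouSet⟩,
    fun P hP ↦ hΦ.modifiedGreen_neg hd hP,
    green_zero_set ▸ hΦ.isOpen_orbitalGoodSet⟩

theorem proposition32 {K : Type*} [NontriviallyNormedField K] [IsUltrametricDist K]
    [CompleteSpace K] [IsAlgClosed K] {N d : ℕ} (hd : 2 ≤ d)
    (φ : ProjDyn.ProjMorphism K N d) (Φ : ProjDyn.PolyMap K N)
    (hΦ : ProjDyn.IsMinimalLift φ Φ) :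
    -- the limit defining the Green function exists, and the modified Green function may be
    -- computed from any lift of a point
    (∀ (x : Fin (N + 1) → K) (hx : x ≠ 0),
      Tendsto (fun n : ℕ => Real.log ‖Φ.app^[n] x‖ / (d : ℝ) ^ n) atTop
        (𝓝 (ProjDyn.modifiedGreen d Φ (Projectivization.mk K x hx) + Real.log ‖x‖))) ∧
    -- (a)
    (∀ P ∈ ProjDyn.orbitalGoodSet φ, ∀ Q ∈ Metric.ball P ‖Φ.res d‖,
      ∀ R ∈ Metric.ball P ‖Φ.res d‖, ∀ n : ℕ, 1 ≤ n →
        dist (φ^[n] Q) (φ^[n] R) ≤ dist Q R) ∧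
    -- (b)
    ((∀ P ∈ ProjDyn.orbitalGoodSet φ,
        Metric.ball P ‖Φ.res d‖ ⊆ ProjDyn.orbitalGoodSet φ) ∧
      IsOpen (ProjDyn.orbitalGoodSet φ)) ∧
    -- (c)
    (ProjDyn.orbitalGoodSet φ = {P | ProjDyn.modifiedGreen d Φ P = 0} ∧
      ProjDyn.orbitalGoodSet φ ⊆ ProjDyn.fatouSet φ) ∧
    -- (d)
    (∀ P ∈ ProjDyn.badSet φ, ProjDyn.modifiedGreen d Φ P < 0) ∧
    -- (e)
    IsOpen {P | ProjDyn.modifiedGreen d Φ P = 0} := by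
  have hball (P : ProjDyn.PSpace K N) : Metric.ball P ‖Φ.res d‖ ⊆ Metric.ball P 1 :=
    Metric.ball_subset_ball (ProjDyn.PolyMap.norm_res_le_one hΦ.integral)
  obtain ⟨hlim, ha, ⟨hb, hopen⟩, hrest⟩ := proposition32_general hd φ Φ hΦ
  exact ⟨hlim, fun P hP Q hQ R hR n _ ↦ ha P hP Q (hball P hQ) R (hball P hR) n,
    ⟨fun P hP ↦ (hball P).trans (hb P hP), hopen⟩, hrest⟩
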